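/- Let $\mathbb{F}=\mathbb{R}$ or $\mathbb{C}$, and let $X$ be a quasi-Banach space over $\mathbb{F}$. A \emph{basis} of $X$ is a sequence $\mathcal{B}=(x_n)_{n=1}^\infty$ whose linear span is dense in $X$ and which admits bounded linear functionals $(x_n^*)_{n=1}^\infty$ on $X$ with $x_n^*(x_k)=\delta_{n,k}$. For finite $A\subseteq\mathbb{N}$ put $S_A(f)=\sum_{n\in A}x_n^*(f)\,x_n$; a finite set $A$ is a \emph{greedy set} of $f$ if $|x_k^*(f)|\le|x_n^*(f)|$ for all $n\in A$ and $k\notin A$. The basis is - \emph{$M$-bounded} if $\sup_n\|x_n\|\,\|x_n^*\|<\infty$, and \emph{semi-normalized} if $0<\inf_n\|x_n\|\le\sup_n\|x_n\|<\infty$; - \emph{quasi-greedy} if it is $M$-bounded, semi-normalized and there is $C<\infty$ with $\|S_A(f)\|\le C\|f\|$ for all $f\in X$ and all finite greedy sets $A$ of $f$; - \emph{almost greedy} if it is $M$-bounded, semi-normalized and there is $C<\infty$ with $\|f-S_A(f)\|\le C\|f-S_D(f)\|$ for all $f\in X$, all finite greedy sets $A$ of $f$ and all $D\subseteq\mathbb{N}$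 with $|D|\le|A|$; - \emph{bidemocratic} if there is $C<\infty$ with $\bigl\|\sum_{n\in A}x_n\bigr\|\,\bigl\|\sum_{n\in D}x_n^*\bigr\|\le C\,m$ for all $m\in\mathbb{N}$ and all $A,D\subseteq\mathbb{N}$ with $\max\{|A|,|D|\}\le m$. Let $[\mathcal{B}^*]$ be the closed linear span of $\mathcal{B}^*=(x_n^*)_{n=1}^\infty$ in $X^*$, let $h_{\mathcal{B},X}\colon X\to[\mathcal{B}^*]^*$ be the map $h_{\mathcal{B},X}(f)(f^*)=f^*(f)$, and let $\mathcal{B}^{**}=(h_{\mathcal{B},X}(x_n))_{n=1}^\infty$. The \emph{Banach envelope} of $X$ is a Banach space $\widehat X$ with a linear contraction $J\colon X\to\widehat X$ such that every bounded linear map $T$ from $X$ to a Banach space factors as $T=S\circ J$ for a unique bounded linear map $S$, and $\|S\|\le\|T\|$. Put $\widehat{\mathcal{B}}=(J(x_n))_{n=1}^\infty$. Two sequences $(x_n)$ and $(y_n)$ in quasi-normed spaces are \emph{equivalent} if there is $C>0$ such that $C^{-1}\bigl\|\sum_{n=1}^N a_nx_n\bigr\|\le\bigl\|\sum_{n=1}^N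 a_ny_n\bigr\|\le C\bigl\|\sum_{n=1}^N a_nx_n\bigr\|$ for all $N$ and all scalars $a_1,\dots,a_N$. **Theorem.** Let $\mathcal{B}$ be a bidemocratic quasi-greedy basis of a quasi-Banach space $X$. Then $\widehat{\mathcal{B}}$ is a basis of $\widehat X$, and: 1. the map $h_{\widehat{\mathcal{B}},\widehat X}\colon\widehat X\to[\widehat{\mathcal{B}}^*]^*$ is an isomorphic embedding, and the sequences $\mathcal{B}^{**}$ and $\widehat{\mathcal{B}}$ are equivalent; 2. $\widehat{\mathcal{B}}$ is an almost greedy basis of $\widehat X$; 3. if $X$ is locally convex (that is, there is $C<\infty$ with $\bigl\|\sum_{j=1}^n f_j\bigr\|\le C\sum_{j=1}^n\|f_j\|$ for all $n$ and all $f_1,\dots,f_n\in X$), then $\mathcal{B}$ and $\mathcal{B}^{**}$ are equivalent. -/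

import Mathlib

universe u

/-- A quasi-norm on a vector space over `𝕜` (the real or the complex field). -/
structure QuasiNorm (𝕜 : Type) (X : Type u) [RCLike 𝕜] [AddCommGroup X] [Module 𝕜 X] where
  toFun : X → ℝ
  nonneg' : ∀ x, 0 ≤ toFun x
  pos' : ∀ x, x ≠ 0 → 0 < toFun x
  smul' : ∀ (t : 𝕜) (x : X), toFun (t • x) = ‖t‖ * toFun x
  quasi_triangle' : ∃ κ : ℝ, 1 ≤ κ ∧ ∀ x y, toFun (x + y) ≤ κ * (toFun x + toFun y)

namespace QuasiNorm

section Basic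

variable {𝕜 : Type} {X : Type u} [RCLike 𝕜] [AddCommGroup X] [Module 𝕜 X]

instance : CoeFun (QuasiNorm 𝕜 X) (fun _ => X → ℝ) := ⟨QuasiNorm.toFun⟩

/-- Every Cauchy sequence converges, so that the space is a quasi-Banach space.  The topology is
metrizable, with the sets `{y | N (y - x) < ε}` as a neighbourhood base at `x`, hence sequences
suffice. -/
def IsQuasiBanach (N : QuasiNorm 𝕜 X) : Prop :=
  ∀ s : ℕ → X,
    (∀ ε : ℝ, 0 < ε → ∃ n₀ : ℕ, ∀ m n : ℕ, n₀ ≤ m → n₀ ≤ n → N (s m - s n) < ε) →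
      ∃ x : X, Filter.Tendsto (fun n => N (s n - x)) Filter.atTop (nhds 0)

/-- Local convexity of a quasi-Banach space, that is, `1`-convexity. -/
def IsLocallyConvex (N : QuasiNorm 𝕜 X) : Prop :=
  ∃ C : ℝ, ∀ (n : ℕ) (f : Fin n → X), N (∑ j, f j) ≤ C * ∑ j, N (f j)

/-- The bounded (equivalently, continuous) linear functionals. -/
def boundedFunctionals (N : QuasiNorm 𝕜 X) : Submodule 𝕜 (X →ₗ[𝕜] 𝕜) where
  carrier := {f | ∃ C : ℝ, 0 ≤ C ∧ ∀ x, ‖f x‖ ≤ C * N x}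
  add_mem' := by
    rintro f g ⟨C, hC, hf⟩ ⟨D, hD, hg⟩
    refine ⟨C + D, by positivity, fun x => ?_⟩
    rw [add_mul]
    exact (norm_add_le _ _).trans (add_le_add (hf x) (hg x))
  zero_mem' := ⟨0, le_rfl, by simp⟩
  smul_mem' := by
    rintro c f ⟨C, hC, hf⟩
    refine ⟨‖c‖ * C, by positivity, fun x => ?_⟩
    rw [LinearMap.smul_apply, norm_smul, mul_assoc]
    exact mul_le_mul_of_nonneg_left (hf x) (norm_nonneg _)

section DualNorm

variable {N : QuasiNorm 𝕜 X}

/-- The dual norm of `f`: the least `C ≥ 0` such that `|f x| ≤ C ‖x‖` for all `x`. -/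
noncomputable def dualNorm (f : N.boundedFunctionals) : ℝ :=
  sInf {C : ℝ | 0 ≤ C ∧ ∀ x, ‖f.1 x‖ ≤ C * N x}

theorem dualNorm_nonneg (f : N.boundedFunctionals) : 0 ≤ dualNorm f :=
  Real.sInf_nonneg fun _ h => h.1

theorem le_dualNorm (f : N.boundedFunctionals) (x : X) : ‖f.1 x‖ ≤ dualNorm f * N x := by
  rcases (N.nonneg' x).eq_or_lt with h | h
  · obtain ⟨C, -, hC⟩ := f.2
    have := hC x
    rw [← h, mul_zero] at this ⊢
    exact this
  · rw [← div_le_iff₀ h]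
    exact le_csInf f.2 fun C hC => (div_le_iff₀ h).2 (hC.2 x)

theorem dualNorm_le {f : N.boundedFunctionals} {C : ℝ} (hC : 0 ≤ C)
    (h : ∀ x, ‖f.1 x‖ ≤ C * N x) : dualNorm f ≤ C :=
  csInf_le ⟨0, fun _ h => h.1⟩ ⟨hC, h⟩

theorem dualNorm_smul_le (c : 𝕜) (f : N.boundedFunctionals) :
    dualNorm (c • f) ≤ ‖c‖ * dualNorm f :=
  dualNorm_le (mul_nonneg (norm_nonneg _) (dualNorm_nonneg _)) fun x => by
    rw [Submodule.coe_smul, LinearMap.smul_apply, norm_smul, mul_assoc]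
    exact mul_le_mul_of_nonneg_left (le_dualNorm f x) (norm_nonneg _)

theorem dualNorm_zero : dualNorm (0 : N.boundedFunctionals) = 0 :=
  le_antisymm (dualNorm_le le_rfl (by simp)) (dualNorm_nonneg _)

theorem dualNorm_core :
    letI : Norm N.boundedFunctionals := ⟨dualNorm⟩
    NormedSpace.Core 𝕜 N.boundedFunctionals :=
  letI : Norm N.boundedFunctionals := ⟨dualNorm⟩
  { norm_nonneg := dualNorm_nonneg
    norm_smul := fun c f => by
      change dualNorm (c • f) = ‖c‖ * dualNorm f
      refine le_antisymm (dualNorm_smul_le c f) ?_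
      rcases eq_or_ne c 0 with rfl | hc
      · rw [norm_zero, zero_mul]
        exact dualNorm_nonneg _
      · have := dualNorm_smul_le c⁻¹ (c • f)
        rw [smul_smul, inv_mul_cancel₀ hc, one_smul, norm_inv] at this
        calc ‖c‖ * dualNorm f ≤ ‖c‖ * (‖c‖⁻¹ * dualNorm (c • f)) :=
              mul_le_mul_of_nonneg_left this (norm_nonneg _)
          _ = dualNorm (c • f) := by
              rw [← mul_assoc, mul_inv_cancel₀ (norm_ne_zero_iff.2 hc), one_mul]
    norm_triangle := fun f g =>
      dualNorm_le (add_nonneg (dualNorm_nonneg _) (dualNorm_nonneg _)) fun x => by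
        rw [Submodule.coe_add, LinearMap.add_apply, add_mul]
        exact (norm_add_le _ _).trans (add_le_add (le_dualNorm f x) (le_dualNorm g x))
    norm_eq_zero_iff := fun f => by
      change dualNorm f = 0 ↔ f = 0
      constructor
      · intro h
        ext x
        have := le_dualNorm f x
        rw [h, zero_mul] at this
        simpa using this
      · rintro rfl
        exact dualNorm_zero }

end DualNorm

/-- The dual space `X^*`: the bounded linear functionals with the dual norm. -/
def Dual (N : QuasiNorm 𝕜 X) : Type u := N.boundedFunctionals

namespace Dual

variable {N : QuasiNorm 𝕜 X}

noncomputable instance : NormedAddCommGroup N.Dual :=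
  @NormedAddCommGroup.ofCore 𝕜 N.boundedFunctionals _ _ _ ⟨dualNorm⟩ dualNorm_core

noncomputable instance : NormedSpace 𝕜 N.Dual :=
  { N.boundedFunctionals.module with norm_smul_le := dualNorm_smul_le }

/-- The linear functional underlying an element of `X^*`. -/
noncomputable def toLin : N.Dual →ₗ[𝕜] (X →ₗ[𝕜] 𝕜) := N.boundedFunctionals.subtype

noncomputable instance : CoeFun N.Dual (fun _ => X → 𝕜) := ⟨fun f => toLin f⟩

theorem le_norm (f : N.Dual) (x : X) : ‖f x‖ ≤ ‖f‖ * N x := le_dualNorm f x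

theorem norm_le {f : N.Dual} {C : ℝ} (hC : 0 ≤ C) (h : ∀ x, ‖f x‖ ≤ C * N x) : ‖f‖ ≤ C :=
  dualNorm_le hC h

end Dual

/-- The functional `f^* ↦ f^* x` on `X^*`. -/
noncomputable def bidualMap (N : QuasiNorm 𝕜 X) : X →ₗ[𝕜] StrongDual 𝕜 N.Dual where
  toFun x := LinearMap.mkContinuous
    { toFun := fun f => f x
      map_add' := fun f g => by rw [map_add, LinearMap.add_apply]
      map_smul' := fun c f => by rw [map_smul, LinearMap.smul_apply, RingHom.id_apply] }
    (N x) (fun f => by rw [mul_comm]; exact Dual.le_norm f x)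
  map_add' x y := by ext f; exact map_add (Dual.toLin f) x y
  map_smul' c x := by ext f; exact map_smul (Dual.toLin f) c x

end Basic

/-- The norm of a normed space, regarded as a quasi-norm. -/
def ofNorm (𝕜 : Type) (V : Type u) [RCLike 𝕜] [NormedAddCommGroup V] [NormedSpace 𝕜 V] :
    QuasiNorm 𝕜 V where
  toFun v := ‖v‖
  nonneg' := norm_nonneg
  pos' _ h := norm_pos_iff.2 h
  smul' := norm_smul
  quasi_triangle' := ⟨1, le_rfl, fun x y => by rw [one_mul]; exact norm_add_le x y⟩

section Envelope

variable {𝕜 : Type} {X : Type u} [RCLike 𝕜] [AddCommGroup X] [Module 𝕜 X]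

/-- `(V, J)` is the Banach envelope of `(X, N)`: `V` is a Banach space, `J : X → V` is a linear
contraction, and each bounded linear map `T` from `X` to a Banach space `Y` factors as
`T = S ∘ J` for a unique bounded linear map `S : V → Y`, which satisfies `‖S‖ ≤ ‖T‖`. -/
structure IsBanachEnvelope (N : QuasiNorm 𝕜 X) {V : Type u} [NormedAddCommGroup V]
    [NormedSpace 𝕜 V] (J : X →ₗ[𝕜] V) : Prop where
  complete : CompleteSpace V
  contraction : ∀ x, ‖J x‖ ≤ N x
  universal : ∀ (Y : Type u) [NormedAddCommGroup Y] [NormedSpace 𝕜 Y] [CompleteSpace Y]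
    (T : X →ₗ[𝕜] Y), (∃ C : ℝ, ∀ x, ‖T x‖ ≤ C * N x) →
      ∃ S : V →L[𝕜] Y, (∀ x, S (J x) = T x) ∧
        (∀ S' : V →L[𝕜] Y, (∀ x, S' (J x) = T x) → S' = S) ∧
        ∀ C : ℝ, 0 ≤ C → (∀ x, ‖T x‖ ≤ C * N x) → ‖S‖ ≤ C

/-- The closure in `X^{**}` of the range of the bidual map. -/
noncomputable def envelopeModel (N : QuasiNorm 𝕜 X) : Submodule 𝕜 (StrongDual 𝕜 N.Dual) :=
  (LinearMap.range N.bidualMap).topologicalClosure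

/-- The bidual map, with values in the closure of its range. -/
noncomputable def toEnvelopeModel (N : QuasiNorm 𝕜 X) : X →ₗ[𝕜] N.envelopeModel :=
  N.bidualMap.codRestrict _ fun x =>
    Submodule.le_topologicalClosure _ (LinearMap.mem_range_self _ x)

theorem norm_le_of_dual_bound (N : QuasiNorm 𝕜 X) {Y : Type u} [NormedAddCommGroup Y]
    [NormedSpace 𝕜 Y] (T : X →ₗ[𝕜] Y) {C : ℝ} (hC : 0 ≤ C) (hT : ∀ x, ‖T x‖ ≤ C * N x) (x : X) :
    ‖T x‖ ≤ C * ‖N.bidualMap x‖ := by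
  refine NormedSpace.norm_le_dual_bound 𝕜 _ (by positivity) fun g => ?_
  have hg : ∀ z, ‖(g.toLinearMap ∘ₗ T) z‖ ≤ (‖g‖ * C) * N z := fun z => by
    refine (g.le_opNorm _).trans ?_
    rw [mul_assoc]
    exact mul_le_mul_of_nonneg_left (hT z) (norm_nonneg _)
  let f : N.Dual := ⟨g.toLinearMap ∘ₗ T, ‖g‖ * C, by positivity, hg⟩
  have hf : ‖f‖ ≤ ‖g‖ * C := Dual.norm_le (by positivity) hg
  calc ‖g (T x)‖ = ‖N.bidualMap x f‖ := rfl
    _ ≤ ‖N.bidualMap x‖ * ‖f‖ := (N.bidualMap x).le_opNorm f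
    _ ≤ ‖N.bidualMap x‖ * (‖g‖ * C) := mul_le_mul_of_nonneg_left hf (norm_nonneg _)
    _ = C * ‖N.bidualMap x‖ * ‖g‖ := by ring

theorem IsBanachEnvelope.of_dense {N : QuasiNorm 𝕜 X} {V : Type u} [NormedAddCommGroup V]
    [NormedSpace 𝕜 V] (J : X →ₗ[𝕜] V) (hV : CompleteSpace V) (hJ : ∀ x, ‖J x‖ ≤ N x)
    (hd : DenseRange J) (hle : ∀ x, ‖N.bidualMap x‖ ≤ ‖J x‖) : N.IsBanachEnvelope J where
  complete := hV
  contraction := hJ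
  universal Y _ _ _ T hT := by
    obtain ⟨C₀, hC₀⟩ := hT
    have hb : ∀ C : ℝ, 0 ≤ C → (∀ x, ‖T x‖ ≤ C * N x) → ∀ x, ‖T x‖ ≤ C * ‖J x‖ :=
      fun C hC h x => (norm_le_of_dual_bound N T hC h x).trans
        (mul_le_mul_of_nonneg_left (hle x) hC)
    have h₁ : ∀ x, ‖T x‖ ≤ max C₀ 0 * N x := fun x =>
      (hC₀ x).trans (mul_le_mul_of_nonneg_right (le_max_left _ _) (N.nonneg' x))
    have h₂ : ∃ C : ℝ, ∀ x, ‖T x‖ ≤ C * ‖J x‖ := ⟨_, hb _ (le_max_right _ _) h₁⟩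
    refine ⟨T.extendOfNorm J, fun x => LinearMap.extendOfNorm_eq hd h₂ x,
      fun S' hS' => ?_, fun C hC h => LinearMap.opNorm_extendOfNorm_le hd hC (hb C hC h)⟩
    exact (LinearMap.extendOfNorm_unique hd _ (hb _ (le_max_right _ _) h₁) S'
      (LinearMap.ext hS')).symm

theorem norm_toEnvelopeModel (N : QuasiNorm 𝕜 X) (x : X) :
    ‖N.toEnvelopeModel x‖ = ‖N.bidualMap x‖ := Submodule.coe_norm _

theorem norm_bidualMap_le (N : QuasiNorm 𝕜 X) (x : X) : ‖N.bidualMap x‖ ≤ N x :=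
  (N.bidualMap x).opNorm_le_bound (N.nonneg' x) fun f => by
    rw [mul_comm]; exact Dual.le_norm f x

theorem completeSpace_envelopeModel (N : QuasiNorm 𝕜 X) : CompleteSpace N.envelopeModel :=
  (Submodule.isClosed_topologicalClosure _).completeSpace_coe

theorem denseRange_toEnvelopeModel (N : QuasiNorm 𝕜 X) : DenseRange N.toEnvelopeModel := by
  intro v
  rw [Metric.mem_closure_iff]
  intro ε hε
  obtain ⟨w, ⟨x, rfl⟩, hw⟩ := Metric.mem_closure_iff.1 v.2 ε hε
  exact ⟨_, ⟨x, rfl⟩, hw⟩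

/-- Banach envelopes exist. -/
theorem isBanachEnvelope_toEnvelopeModel (N : QuasiNorm 𝕜 X) :
    N.IsBanachEnvelope (V := N.envelopeModel) N.toEnvelopeModel := by
  have key := IsBanachEnvelope.of_dense (N := N) (V := N.envelopeModel) N.toEnvelopeModel
  exact key N.completeSpace_envelopeModel
    (fun x => (N.norm_toEnvelopeModel x).trans_le (N.norm_bidualMap_le x))
    N.denseRange_toEnvelopeModel (fun x => (N.norm_toEnvelopeModel x).ge)

end Envelope

end QuasiNorm

section Sequences

variable {𝕜 : Type} {X Y : Type u} [RCLike 𝕜] [AddCommGroup X] [Module 𝕜 X]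
  [AddCommGroup Y] [Module 𝕜 Y]

/-- Equivalence of the sequences `x` in `(X, N)` and `y` in `(Y, P)`. -/
def SeqEquivalent (N : QuasiNorm 𝕜 X) (x : ℕ → X) (P : QuasiNorm 𝕜 Y) (y : ℕ → Y) : Prop :=
  ∃ C : ℝ, 0 < C ∧ ∀ (m : ℕ) (a : ℕ → 𝕜),
    C⁻¹ * N (∑ n ∈ Finset.range m, a n • x n) ≤ P (∑ n ∈ Finset.range m, a n • y n) ∧
    P (∑ n ∈ Finset.range m, a n • y n) ≤ C * N (∑ n ∈ Finset.range m, a n • x n)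

/-- A linear map is an isomorphic embedding, that is, an isomorphism onto its range. -/
def IsIsomorphicEmbedding (N : QuasiNorm 𝕜 X) (P : QuasiNorm 𝕜 Y) (T : X →ₗ[𝕜] Y) : Prop :=
  ∃ C : ℝ, 0 < C ∧ ∀ x, C⁻¹ * N x ≤ P (T x) ∧ P (T x) ≤ C * N x

/-- A basis, that is, a complete Markushevich basis, of `(X, N)`, with its coordinate
functionals, which the sequence of vectors determines. -/
structure MarkushevichBasis (N : QuasiNorm 𝕜 X) where
  vec : ℕ → X
  coord : ℕ → N.Dual
  biorthogonal : ∀ n k, coord n (vec k) = if k = n then 1 else 0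
  dense_span : ∀ (f : X) (ε : ℝ), 0 < ε →
    ∃ g ∈ Submodule.span 𝕜 (Set.range vec), N (f - g) < ε

namespace MarkushevichBasis

variable {N : QuasiNorm 𝕜 X} (B : MarkushevichBasis N)

/-- The coordinate projection `S_A` onto a finite set `A`. -/
noncomputable def proj (A : Finset ℕ) (f : X) : X := ∑ n ∈ A, B.coord n f • B.vec n

/-- `A` is a (finite) greedy set of `f`. -/
def IsGreedySet (f : X) (A : Finset ℕ) : Prop :=
  ∀ n ∈ A, ∀ k ∉ A, ‖B.coord k f‖ ≤ ‖B.coord n f‖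

def IsMBounded : Prop := ∃ C : ℝ, ∀ n, N (B.vec n) * ‖B.coord n‖ ≤ C

def IsSemiNormalized : Prop := ∃ c C : ℝ, 0 < c ∧ ∀ n, c ≤ N (B.vec n) ∧ N (B.vec n) ≤ C

def IsQuasiGreedy : Prop :=
  B.IsMBounded ∧ B.IsSemiNormalized ∧
    ∃ C : ℝ, ∀ (f : X) (A : Finset ℕ), B.IsGreedySet f A → N (B.proj A f) ≤ C * N f

def IsAlmostGreedy : Prop :=
  B.IsMBounded ∧ B.IsSemiNormalized ∧
    ∃ C : ℝ, 1 ≤ C ∧ ∀ (f : X) (A D : Finset ℕ), B.IsGreedySet f A → D.card ≤ A.card →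
      N (f - B.proj A f) ≤ C * N (f - B.proj D f)

def IsBidemocratic : Prop :=
  ∃ C : ℝ, 0 < C ∧ ∀ (m : ℕ) (A D : Finset ℕ), A.card ≤ m → D.card ≤ m →
    N (∑ n ∈ A, B.vec n) * ‖∑ n ∈ D, B.coord n‖ ≤ C * m

/-- The closed linear span `[B^*]` in `X^*` of the coordinate functionals. -/
noncomputable def dualSpan : Submodule 𝕜 N.Dual :=
  (Submodule.span 𝕜 (Set.range B.coord)).topologicalClosure

/-- The map `h_{B,X} : X → [B^*]^*`: the bidual map followed by restriction to `[B^*]`. -/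
noncomputable def bidualMap : X →ₗ[𝕜] StrongDual 𝕜 B.dualSpan where
  toFun f := (N.bidualMap f).comp B.dualSpan.subtypeL
  map_add' f g := by rw [map_add, ContinuousLinearMap.add_comp]
  map_smul' c f := by rw [map_smul, ContinuousLinearMap.smul_comp, RingHom.id_apply]

theorem bidualMap_apply (f : X) (g : B.dualSpan) : B.bidualMap f g = (g : N.Dual) f := rfl

theorem coord_mem_dualSpan (n : ℕ) : B.coord n ∈ B.dualSpan :=
  Submodule.le_topologicalClosure _ (Submodule.subset_span ⟨n, rfl⟩)

/-- The bidual sequence `B^{**}` in `[B^*]^*`. -/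
noncomputable def bidualSeq (n : ℕ) : StrongDual 𝕜 B.dualSpan := B.bidualMap (B.vec n)

/-- `B^{**}` consists of the coordinate functionals of the basis `B^*` of `[B^*]`. -/
theorem bidualSeq_coord (n k : ℕ) :
    B.bidualSeq n ⟨B.coord k, B.coord_mem_dualSpan k⟩ = if k = n then 1 else 0 := by
  rw [bidualSeq, bidualMap_apply, B.biorthogonal]
  simp only [eq_comm]

end MarkushevichBasis

end Sequences

/-! Everything rests on one duality estimate. Let `φ m`, `ψ m` bound sums of at most `m` basis
vectors, resp. coordinate functionals; bidemocracy gives `φ m * ψ m ≤ C m`. Let `A` be a greedy set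
of the coefficients `f (x_n)` of a functional `f`, and `D` a greedy set of `x` with `|A| = |D| = m`.
On `A \ D` every coefficient of `x` is at most the average of those over `D`, which is at most `4 ψ
m ‖x‖ / m`, while the `|f (x_n)|` sum to at most `4 φ m ‖f‖`; `D \ A` is symmetric. So `f (S_A x)`
and `f (S_D x)` differ by at most `32 C ‖f‖ ‖x‖` (`norm_sum_sub_sum_le`).

Hence quasi-greediness passes from the basis to its dual basis (`isDualQuasiGreedy`). Since `X` and
its envelope have the same dual, the image basis inherits this and the bounds (`exists_basis`). In a
Banach space the estimate can be used backwards, giving a quasi-greedy and then an almost greedy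
basis.

For the embedding, a functional is replaced by its projection onto a greedy set, which lies in the
span of the coordinate functionals and has comparable norm (`exists_mem_span_coord`). This needs
coefficients tending to zero; if they do not, the basis dominates `ℓ₁` and truncations are trivially
bounded. Finally, the envelope norm is the bidual norm (`norm_apply`), which under local convexity
is equivalent to the quasi-norm by Hahn–Banach. -/

/-! ### Scalar inequalities and existence of greedy sets. -/

section Scalars

variable {ι 𝕜 : Type*} [RCLike 𝕜]

/-- If all partial sums over subsets are bounded by `M`, so is the absolute sum, up to the
factor `2`, over the reals. -/
theorem Finset.sum_abs_le_two_mul (A : Finset ι) (z : ι → ℝ) {M : ℝ}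
    (h : ∀ A' ⊆ A, |∑ n ∈ A', z n| ≤ M) : ∑ n ∈ A, |z n| ≤ 2 * M := by
  rw [← Finset.sum_filter_add_sum_filter_not A (fun n => 0 ≤ z n)]
  have h₁ : ∑ n ∈ A with 0 ≤ z n, |z n| ≤ M := by
    rw [Finset.sum_congr rfl fun n hn => abs_of_nonneg (Finset.mem_filter.1 hn).2]
    exact (le_abs_self _).trans (h _ (Finset.filter_subset _ _))
  have h₂ : ∑ n ∈ A with ¬ 0 ≤ z n, |z n| ≤ M := by
    rw [Finset.sum_congr rfl fun n hn => abs_of_neg (not_le.1 (Finset.mem_filter.1 hn).2),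
      Finset.sum_neg_distrib]
    exact (neg_le_abs _).trans (h _ (Finset.filter_subset _ _))
  linarith

/-- If all partial sums over subsets are bounded by `M`, so is the absolute sum, up to the
factor `4`, over the real or complex field. -/
theorem Finset.sum_norm_le_four_mul (A : Finset ι) (z : ι → 𝕜) {M : ℝ}
    (h : ∀ A' ⊆ A, ‖∑ n ∈ A', z n‖ ≤ M) : ∑ n ∈ A, ‖z n‖ ≤ 4 * M := by
  have hre : ∑ n ∈ A, |RCLike.re (z n)| ≤ 2 * M :=
    A.sum_abs_le_two_mul _ fun A' hA' => by
      rw [← map_sum]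
      exact (RCLike.abs_re_le_norm _).trans (h A' hA')
  have him : ∑ n ∈ A, |RCLike.im (z n)| ≤ 2 * M :=
    A.sum_abs_le_two_mul _ fun A' hA' => by
      rw [← map_sum]
      exact (RCLike.abs_im_le_norm _).trans (h A' hA')
  calc ∑ n ∈ A, ‖z n‖ ≤ ∑ n ∈ A, (|RCLike.re (z n)| + |RCLike.im (z n)|) :=
        Finset.sum_le_sum fun n _ => by
          refine abs_le_of_sq_le_sq' ?_ (by positivity) |>.2
          rw [RCLike.norm_sq_eq_def, add_sq, sq_abs, sq_abs]
          nlinarith [mul_nonneg (abs_nonneg (RCLike.re (z n))) (abs_nonneg (RCLike.im (z n)))]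
    _ ≤ 4 * M := by rw [Finset.sum_add_distrib]; linarith

/-- Averaging: each `β n` lies below all `b k` on `Q`, hence below their mean `T / |Q|`. -/
theorem Finset.sum_mul_le_of_cross_le {P Q : Finset ι} (hPQ : P.card ≤ Q.card) {a b β : ι → ℝ}
    (ha : ∀ n, 0 ≤ a n) (hb : ∀ n, 0 ≤ b n) (hβ : ∀ n ∈ P, ∀ k ∈ Q, β n ≤ b k) {S T K : ℝ}
    (hS : ∑ n ∈ P, a n ≤ S) (hT : ∑ n ∈ Q, b n ≤ T) (hST : S * T ≤ K * Q.card) (hK : 0 ≤ K) :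
    ∑ n ∈ P, a n * β n ≤ K := by
  rcases Q.eq_empty_or_nonempty with rfl | hQ
  · rw [Finset.card_empty, Nat.le_zero, Finset.card_eq_zero] at hPQ
    simpa [hPQ] using hK
  have hc : (0 : ℝ) < Q.card := by exact_mod_cast hQ.card_pos
  have hβ' : ∀ n ∈ P, Q.card * β n ≤ T := fun n hn => by
    have := Q.card_nsmul_le_sum b (β n) (hβ n hn)
    rw [nsmul_eq_mul] at this
    exact this.trans hT
  have hT₀ : 0 ≤ T := (Finset.sum_nonneg fun n _ => hb n).trans hT
  refine le_of_mul_le_mul_left ?_ hc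
  calc Q.card * ∑ n ∈ P, a n * β n = ∑ n ∈ P, a n * (Q.card * β n) := by
        rw [Finset.mul_sum]
        exact Finset.sum_congr rfl fun n _ => by ring
    _ ≤ ∑ n ∈ P, a n * T :=
        Finset.sum_le_sum fun n hn => mul_le_mul_of_nonneg_left (hβ' n hn) (ha n)
    _ = (∑ n ∈ P, a n) * T := (Finset.sum_mul _ _ _).symm
    _ ≤ S * T := mul_le_mul_of_nonneg_right hS hT₀
    _ ≤ Q.card * K := by rwa [mul_comm (Q.card : ℝ)]

/-- Bounding one factor at a time needs no boundedness or nonemptiness: `Real.sSup_le` asks only for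
a nonnegative upper bound. -/
theorem Real.sSup_mul_sSup_le {S T : Set ℝ} {c : ℝ} (hS : ∀ s ∈ S, 0 ≤ s) (hT : ∀ t ∈ T, 0 ≤ t)
    (hc : 0 ≤ c) (h : ∀ s ∈ S, ∀ t ∈ T, s * t ≤ c) : sSup S * sSup T ≤ c := by
  have key : ∀ s ∈ S, s * sSup T ≤ c := fun s hs => by
    rcases (hS s hs).eq_or_lt with h0 | h0
    · rwa [← h0, zero_mul]
    · rw [mul_comm, ← le_div_iff₀ h0]
      refine Real.sSup_le (fun t ht => ?_) (by positivity)
      rw [le_div_iff₀ h0, mul_comm]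
      exact h s hs t ht
  rcases (Real.sSup_nonneg hT).eq_or_lt with h0 | h0
  · rwa [← h0, mul_zero]
  · rw [← le_div_iff₀ h0]
    refine Real.sSup_le (fun s hs => ?_) (by positivity)
    rw [le_div_iff₀ h0]
    exact key s hs

/-- A function with finite superlevel sets has greedy sets of any cardinality. -/
theorem exists_greedySet [Infinite ι] (a : ι → ℝ) (ha : ∀ n, 0 ≤ a n)
    (h : ∀ δ > 0, {n | δ ≤ a n}.Finite) (m : ℕ) :
    ∃ A : Finset ι, A.card = m ∧ ∀ n ∈ A, ∀ k ∉ A, a k ≤ a n := by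
  classical
  induction m with
  | zero => exact ⟨∅, by simp⟩
  | succ m ih =>
    obtain ⟨A, hA, hg⟩ := ih
    obtain ⟨p, hp, hmax⟩ : ∃ p ∉ A, ∀ k ∉ A, a k ≤ a p := by
      by_cases hall : ∀ k ∉ A, a k ≤ 0
      · obtain ⟨p, hp⟩ := Infinite.exists_notMem_finset A
        exact ⟨p, hp, fun k hk => (hall k hk).trans (ha p)⟩
      push Not at hall
      obtain ⟨q, hq, hpq⟩ := hall
      -- Only indices with value at least `a q > 0` compete for the maximum, and they are finitely
      -- many.
      have hfin := (h (a q) hpq).subset (Set.inter_subset_left (t := {n | n ∉ A}))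
      obtain ⟨r, hr, hrm⟩ := hfin.exists_maximalFor a _ ⟨q, le_refl (a q), hq⟩
      refine ⟨r, hr.2, fun k hk => ?_⟩
      by_contra! hlt
      exact absurd (hrm ⟨hr.1.trans hlt.le, hk⟩ hlt.le) (not_le.2 hlt)
    refine ⟨insert p A, by rw [Finset.card_insert_of_notMem hp, hA], fun n hn k hk => ?_⟩
    rw [Finset.mem_insert, not_or] at hk
    rcases Finset.mem_insert.1 hn with rfl | hn
    · exact hmax k hk.2
    · exact hg n hn k hk.2

theorem Finset.norm_sum_sub_sum_le [DecidableEq ι] (A B : Finset ι) (z : ι → 𝕜) :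
    ‖∑ n ∈ A, z n - ∑ n ∈ B, z n‖ ≤ ∑ n ∈ A \ B, ‖z n‖ + ∑ n ∈ B \ A, ‖z n‖ := by
  rw [← Finset.sum_sdiff_sub_sum_sdiff]
  exact (norm_sub_le _ _).trans (add_le_add (norm_sum_le _ _) (norm_sum_le _ _))

end Scalars

/-! ### Fundamental functions of a basis and of its dual basis. -/

namespace MarkushevichBasis

variable {𝕜 : Type} {X : Type u} [RCLike 𝕜] [AddCommGroup X] [Module 𝕜 X]
  {N : QuasiNorm 𝕜 X} (B : MarkushevichBasis N)

/-- `φ` and `ψ` dominate the fundamental functions of the basis and of its dual, and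
`φ m * ψ m ≤ C m`. -/
structure HasBidemocracyBounds (φ ψ : ℕ → ℝ) (C : ℝ) : Prop where
  vec_le : ∀ (m : ℕ) (A : Finset ℕ), A.card ≤ m → N (∑ n ∈ A, B.vec n) ≤ φ m
  coord_le : ∀ (m : ℕ) (A : Finset ℕ), A.card ≤ m → ‖∑ n ∈ A, B.coord n‖ ≤ ψ m
  mul_le : ∀ m : ℕ, φ m * ψ m ≤ C * m

/-- The dual basis satisfies the quasi-greedy estimate on the whole dual space. -/
def IsDualQuasiGreedy (C : ℝ) : Prop :=
  ∀ (f : N.Dual) (A : Finset ℕ), (∀ n ∈ A, ∀ k ∉ A, ‖f (B.vec k)‖ ≤ ‖f (B.vec n)‖) →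
    ‖∑ n ∈ A, f (B.vec n) • B.coord n‖ ≤ C * ‖f‖

variable {B}

theorem coord_vec_ne_zero (n : ℕ) : B.coord n ≠ 0 ∧ B.vec n ≠ 0 := by
  have h := B.biorthogonal n n
  rw [if_pos rfl] at h
  constructor <;> intro h0 <;> rw [h0] at h <;> simp at h

theorem IsBidemocratic.exists_bounds (h : B.IsBidemocratic) :
    ∃ φ ψ C, B.HasBidemocracyBounds φ ψ C := by
  obtain ⟨C, hC, h⟩ := h
  -- Pairing with a single index keeps the suprema below finite; for `m = 0` only the empty set
  -- occurs.
  have hv : ∀ (m : ℕ), 1 ≤ m → ∀ A : Finset ℕ, A.card ≤ m →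
      N (∑ n ∈ A, B.vec n) ≤ C * m / ‖B.coord 0‖ := fun m hm A hA => by
    rw [le_div_iff₀ (norm_pos_iff.2 (coord_vec_ne_zero 0).1)]
    simpa using h m A {0} hA (by simpa using hm)
  have hc : ∀ (m : ℕ), 1 ≤ m → ∀ A : Finset ℕ, A.card ≤ m →
      ‖∑ n ∈ A, B.coord n‖ ≤ C * m / N (B.vec 0) := fun m hm A hA => by
    rw [le_div_iff₀ (N.pos' _ (coord_vec_ne_zero 0).2), mul_comm]
    simpa using h m {0} A (by simpa using hm) hA
  have hN0 : N 0 = 0 := by simpa using N.smul' 0 0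
  have hbv : ∀ m : ℕ, BddAbove ((fun A : Finset ℕ => N (∑ n ∈ A, B.vec n)) ''
      {A | A.card ≤ m}) := fun m => by
    rcases Nat.eq_zero_or_pos m with rfl | hm
    · exact ⟨0, by rintro _ ⟨A, hA, rfl⟩; simp_all⟩
    · exact ⟨_, by rintro _ ⟨A, hA, rfl⟩; exact hv m hm A hA⟩
  have hbc : ∀ m : ℕ, BddAbove ((fun A : Finset ℕ => ‖∑ n ∈ A, B.coord n‖) ''
      {A | A.card ≤ m}) := fun m => by
    rcases Nat.eq_zero_or_pos m with rfl | hm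
    · exact ⟨0, by rintro _ ⟨A, hA, rfl⟩; simp_all⟩
    · exact ⟨_, by rintro _ ⟨A, hA, rfl⟩; exact hc m hm A hA⟩
  refine ⟨_, _, C, fun m A hA => le_csSup (hbv m) ⟨A, hA, rfl⟩,
    fun m A hA => le_csSup (hbc m) ⟨A, hA, rfl⟩, fun m => ?_⟩
  refine Real.sSup_mul_sSup_le ?_ ?_ (by positivity) ?_
  · rintro _ ⟨A, -, rfl⟩
    exact N.nonneg' _
  · rintro _ ⟨A, -, rfl⟩
    exact norm_nonneg _
  · rintro _ ⟨A, hA, rfl⟩ _ ⟨D, hD, rfl⟩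
    exact h m A D hA hD

end MarkushevichBasis

/-! ### The pairing estimate and its consequences for the dual basis. -/

namespace MarkushevichBasis

section Bounds

variable {𝕜 : Type} {X : Type u} [RCLike 𝕜] [AddCommGroup X] [Module 𝕜 X]
  {N : QuasiNorm 𝕜 X} {B : MarkushevichBasis N}

theorem sum_smul_coord_apply (A : Finset ℕ) (c : ℕ → 𝕜) (x : X) :
    QuasiNorm.Dual.toLin (∑ n ∈ A, c n • B.coord n) x = ∑ n ∈ A, c n * B.coord n x := by
  rw [map_sum, LinearMap.sum_apply]
  exact Finset.sum_congr rfl fun n _ => by rw [map_smul, LinearMap.smul_apply, smul_eq_mul]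

theorem sum_smul_coord_apply_vec (A : Finset ℕ) (c : ℕ → 𝕜) (k : ℕ) :
    QuasiNorm.Dual.toLin (∑ n ∈ A, c n • B.coord n) (B.vec k) = if k ∈ A then c k else 0 := by
  rw [sum_smul_coord_apply]
  simp only [B.biorthogonal, mul_ite, mul_one, mul_zero]
  rw [Finset.sum_ite_eq]

theorem coord_proj (A : Finset ℕ) (x : X) (k : ℕ) :
    B.coord k (B.proj A x) = if k ∈ A then B.coord k x else 0 := by
  rw [proj, map_sum]
  simp only [map_smul, B.biorthogonal, smul_eq_mul, mul_ite, mul_one, mul_zero]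
  simp only [eq_comm (b := k)]
  rw [Finset.sum_ite_eq]

theorem apply_proj (f : N.Dual) (A : Finset ℕ) (x : X) :
    f (B.proj A x) = ∑ n ∈ A, f (B.vec n) * B.coord n x := by
  rw [proj, map_sum]
  exact Finset.sum_congr rfl fun n _ => by rw [map_smul, smul_eq_mul, mul_comm]

namespace HasBidemocracyBounds

variable {φ ψ : ℕ → ℝ} {C : ℝ} (hB : B.HasBidemocracyBounds φ ψ C)

include hB

theorem vec_bound_nonneg (m : ℕ) : 0 ≤ φ m :=
  (N.nonneg' _).trans (hB.vec_le m ∅ (Nat.zero_le _))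

theorem coord_bound_nonneg (m : ℕ) : 0 ≤ ψ m :=
  (norm_nonneg _).trans (hB.coord_le m ∅ (Nat.zero_le _))

theorem const_nonneg : 0 ≤ C := by
  simpa using (mul_nonneg (hB.vec_bound_nonneg 1) (hB.coord_bound_nonneg 1)).trans (hB.mul_le 1)

theorem vec_one_le (n : ℕ) : N (B.vec n) ≤ φ 1 := by
  simpa using hB.vec_le 1 {n} (by simp)

theorem coord_one_le (n : ℕ) : ‖B.coord n‖ ≤ ψ 1 := by
  simpa using hB.coord_le 1 {n} (by simp)

theorem norm_apply_vec_le (f : N.Dual) (n : ℕ) : ‖f (B.vec n)‖ ≤ φ 1 * ‖f‖ := by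
  rw [mul_comm]
  exact (QuasiNorm.Dual.le_norm f _).trans
    (mul_le_mul_of_nonneg_left (hB.vec_one_le n) (norm_nonneg _))

/-- The bounds control plain sums over subsets only; the factor `4` pays for the signs. -/
theorem sum_norm_vec_le (f : N.Dual) {m : ℕ} {A : Finset ℕ} (hA : A.card ≤ m) :
    ∑ n ∈ A, ‖f (B.vec n)‖ ≤ 4 * (φ m * ‖f‖) :=
  A.sum_norm_le_four_mul _ fun A' hA' => by
    rw [← map_sum, mul_comm]
    exact (QuasiNorm.Dual.le_norm f _).trans (mul_le_mul_of_nonneg_left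
      (hB.vec_le m A' ((Finset.card_le_card hA').trans hA)) (norm_nonneg _))

theorem sum_norm_coord_le (x : X) {m : ℕ} {A : Finset ℕ} (hA : A.card ≤ m) :
    ∑ n ∈ A, ‖B.coord n x‖ ≤ 4 * (ψ m * N x) :=
  A.sum_norm_le_four_mul _ fun A' hA' => by
    rw [← LinearMap.sum_apply, ← map_sum]
    exact (QuasiNorm.Dual.le_norm _ x).trans (mul_le_mul_of_nonneg_right
      (hB.coord_le m A' ((Finset.card_le_card hA').trans hA)) (N.nonneg' _))

theorem product_le (f : N.Dual) (x : X) (m : ℕ) :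
    4 * (φ m * ‖f‖) * (4 * (ψ m * N x)) ≤ 16 * C * ‖f‖ * N x * m := by
  have h := mul_le_mul_of_nonneg_right (hB.mul_le m)
    (mul_nonneg (norm_nonneg f) (N.nonneg' x))
  calc 4 * (φ m * ‖f‖) * (4 * (ψ m * N x)) = 16 * (φ m * ψ m * (‖f‖ * N x)) := by ring
    _ ≤ 16 * (C * m * (‖f‖ * N x)) := by linarith
    _ = 16 * C * ‖f‖ * N x * m := by ring

theorem pairing_const_nonneg (f : N.Dual) (x : X) : 0 ≤ 16 * C * ‖f‖ * N x := by
  have := hB.const_nonneg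
  have := N.nonneg' x
  positivity

/-- `β` is left free because it will also be the coefficients of a vector other than `x`. -/
theorem sum_norm_vec_mul_le (f : N.Dual) (x : X) {P Q : Finset ℕ} (hPQ : P.card ≤ Q.card)
    {β : ℕ → ℝ} (hβ : ∀ n ∈ P, ∀ k ∈ Q, β n ≤ ‖B.coord k x‖) :
    ∑ n ∈ P, ‖f (B.vec n)‖ * β n ≤ 16 * C * ‖f‖ * N x :=
  Finset.sum_mul_le_of_cross_le hPQ (fun _ => norm_nonneg _) (fun _ => norm_nonneg _) hβ
    (hB.sum_norm_vec_le f hPQ) (hB.sum_norm_coord_le x le_rfl) (hB.product_le f x _)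
    (hB.pairing_const_nonneg f x)

theorem sum_norm_coord_mul_le (f : N.Dual) (x : X) {P Q : Finset ℕ} (hPQ : P.card ≤ Q.card)
    {β : ℕ → ℝ} (hβ : ∀ n ∈ P, ∀ k ∈ Q, β n ≤ ‖f (B.vec k)‖) :
    ∑ n ∈ P, ‖B.coord n x‖ * β n ≤ 16 * C * ‖f‖ * N x :=
  Finset.sum_mul_le_of_cross_le hPQ (fun _ => norm_nonneg _) (fun _ => norm_nonneg _) hβ
    (hB.sum_norm_coord_le x hPQ) (hB.sum_norm_vec_le f le_rfl)
    ((mul_comm _ _).trans_le (hB.product_le f x _)) (hB.pairing_const_nonneg f x)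

/-- Projections onto greedy sets of `f` and onto greedy sets of `x` of the same cardinality
have almost the same effect on `f x`. -/
theorem norm_sum_sub_sum_le (f : N.Dual) (x : X) {A D : Finset ℕ} (hAD : A.card = D.card)
    (hA : ∀ n ∈ A, ∀ k ∉ A, ‖f (B.vec k)‖ ≤ ‖f (B.vec n)‖) (hD : B.IsGreedySet x D) :
    ‖∑ n ∈ A, f (B.vec n) * B.coord n x - ∑ n ∈ D, f (B.vec n) * B.coord n x‖ ≤
      32 * C * ‖f‖ * N x := by
  have h₁ := hB.sum_norm_vec_mul_le f x (P := A \ D) (Q := D)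
    ((Finset.card_le_card Finset.sdiff_subset).trans hAD.le)
    fun n hn k hk => hD k hk n (Finset.mem_sdiff.1 hn).2
  have h₂ := hB.sum_norm_coord_mul_le f x (P := D \ A) (Q := A)
    ((Finset.card_le_card Finset.sdiff_subset).trans hAD.ge)
    fun n hn k hk => hA k hk n (Finset.mem_sdiff.1 hn).2
  have h₃ := Finset.norm_sum_sub_sum_le A D fun n => f (B.vec n) * B.coord n x
  simp only [norm_mul] at h₃
  simp only [mul_comm ‖B.coord _ x‖] at h₂
  linarith

/-- The coordinate functionals are uniformly bounded by `ψ 1`, so off the support of a close finite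
combination the coefficients of `x` are below `δ`. -/
theorem finite_coord_superlevel (x : X) (δ : ℝ) (hδ : 0 < δ) :
    {n | δ ≤ ‖B.coord n x‖}.Finite := by
  have hψ := hB.coord_bound_nonneg 1
  obtain ⟨g, hg, hxg⟩ := B.dense_span x (δ / (ψ 1 + 1)) (by positivity)
  obtain ⟨c, rfl⟩ := Finsupp.mem_span_range_iff_exists_finsupp.1 hg
  refine c.support.finite_toSet.subset fun n hn => ?_
  by_contra hc
  have h0 : B.coord n (c.sum fun i a => a • B.vec i) = 0 := by
    rw [Finsupp.sum, map_sum]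
    refine Finset.sum_eq_zero fun i hi => ?_
    rw [map_smul, B.biorthogonal, if_neg, smul_zero]
    rintro rfl
    exact hc hi
  have h := QuasiNorm.Dual.le_norm (B.coord n) (x - c.sum fun i a => a • B.vec i)
  rw [map_sub, h0, sub_zero] at h
  rw [lt_div_iff₀ (by positivity)] at hxg
  have h₁ := mul_le_mul_of_nonneg_right (hB.coord_one_le n)
    (N.nonneg' (x - c.sum fun i a => a • B.vec i))
  have hn' : δ ≤ ‖B.coord n x‖ := hn
  nlinarith [N.nonneg' (x - c.sum fun i a => a • B.vec i)]

theorem isDualQuasiGreedy (hq : B.IsQuasiGreedy) : ∃ K, 0 ≤ K ∧ B.IsDualQuasiGreedy K := by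
  obtain ⟨-, -, Q, hQ⟩ := hq
  have hC := hB.const_nonneg
  refine ⟨|Q| + 32 * C, by positivity, fun f A hA => ?_⟩
  refine QuasiNorm.Dual.norm_le (by positivity) fun x => ?_
  -- For each `x`, trade `A` for a greedy set of `x` of the same size, where the hypothesis applies;
  -- the trade costs `32 * C`.
  obtain ⟨D, hD, hg⟩ := exists_greedySet (fun n => ‖B.coord n x‖) (fun _ => norm_nonneg _)
    (hB.finite_coord_superlevel x) A.card
  have h₁ : ‖∑ n ∈ D, f (B.vec n) * B.coord n x‖ ≤ |Q| * ‖f‖ * N x := by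
    rw [← apply_proj]
    calc ‖f (B.proj D x)‖ ≤ ‖f‖ * N (B.proj D x) := QuasiNorm.Dual.le_norm _ _
      _ ≤ ‖f‖ * (|Q| * N x) := mul_le_mul_of_nonneg_left ((hQ x D hg).trans
          (mul_le_mul_of_nonneg_right (le_abs_self Q) (N.nonneg' x))) (norm_nonneg _)
      _ = |Q| * ‖f‖ * N x := by ring
  have h₂ := hB.norm_sum_sub_sum_le f x hD.symm hA hg
  rw [sum_smul_coord_apply]
  have h₃ := norm_add_le (∑ n ∈ A, f (B.vec n) * B.coord n x -
    ∑ n ∈ D, f (B.vec n) * B.coord n x) (∑ n ∈ D, f (B.vec n) * B.coord n x)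
  rw [sub_add_cancel] at h₃
  linarith

/-- Either all functionals have coefficients tending to zero, or the basis dominates the unit
vector basis of `ℓ₁`. -/
theorem finite_superlevel_or_dominates_l1 :
    (∀ (f : N.Dual) (δ : ℝ), 0 < δ → {n | δ ≤ ‖f (B.vec n)‖}.Finite) ∨
      ∃ M, 0 ≤ M ∧ ∀ (A : Finset ℕ) (x : X), ∑ n ∈ A, ‖B.coord n x‖ ≤ M * N x := by
  refine or_iff_not_imp_left.2 fun h => ?_
  push Not at h
  obtain ⟨f, δ, hδ, hinf⟩ := h
  have hC := hB.const_nonneg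
  refine ⟨4 * (4 * ‖f‖ * C / δ), by positivity, fun A x => ?_⟩
  rcases A.eq_empty_or_nonempty with rfl | hA
  · have := N.nonneg' x
    rw [Finset.sum_empty]
    positivity
  have hm : (0 : ℝ) < A.card := by exact_mod_cast hA.card_pos
  obtain ⟨D, hDs, hD⟩ := Set.Infinite.exists_subset_card_eq hinf A.card
  -- Infinitely many coefficients of size at least `δ` force `φ` to grow linearly, so bidemocracy
  -- keeps `ψ` bounded.
  have h₁ : A.card * δ ≤ 4 * (φ A.card * ‖f‖) := by
    refine le_trans ?_ (hB.sum_norm_vec_le f hD.le)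
    rw [← nsmul_eq_mul, ← hD]
    exact D.card_nsmul_le_sum _ _ fun n hn => hDs hn
  have h₂ : ψ A.card ≤ 4 * ‖f‖ * C / δ := by
    rw [le_div_iff₀ hδ]
    refine le_of_mul_le_mul_left ?_ hm
    have h₃ := mul_le_mul_of_nonneg_right h₁ (hB.coord_bound_nonneg A.card)
    have h₄ := mul_le_mul_of_nonneg_left (hB.mul_le A.card) (norm_nonneg f)
    linarith
  refine (hB.sum_norm_coord_le x le_rfl).trans ?_
  rw [mul_assoc]
  exact mul_le_mul_of_nonneg_left (mul_le_mul_of_nonneg_right h₂ (N.nonneg' x)) (by norm_num)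

/-- On finite combinations of the basis vectors, each functional agrees with a functional in the
span of the coordinate functionals, of comparable norm. -/
theorem exists_mem_span_coord {K : ℝ} (hK : 0 ≤ K) (hd : B.IsDualQuasiGreedy K) :
    ∃ L, 0 < L ∧ ∀ x ∈ Submodule.span 𝕜 (Set.range B.vec), ∀ f : N.Dual,
      ∃ g ∈ Submodule.span 𝕜 (Set.range B.coord), ‖g‖ ≤ L * ‖f‖ ∧
        QuasiNorm.Dual.toLin g x = f x := by
  have key : ∀ (c : ℕ →₀ 𝕜) (f g : N.Dual), (∀ n ∈ c.support, g (B.vec n) = f (B.vec n)) →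
      g (c.sum fun i a => a • B.vec i) = f (c.sum fun i a => a • B.vec i) :=
    fun c f g h => by
      rw [Finsupp.sum, map_sum, map_sum]
      exact Finset.sum_congr rfl fun n hn => by rw [map_smul, map_smul, h n hn]
  have hmem : ∀ (A : Finset ℕ) (a : ℕ → 𝕜),
      ∑ n ∈ A, a n • B.coord n ∈ Submodule.span 𝕜 (Set.range B.coord) := fun A a =>
    Submodule.sum_mem _ fun n _ => Submodule.smul_mem _ _ (Submodule.subset_span ⟨n, rfl⟩)
  rcases hB.finite_superlevel_or_dominates_l1 with h | ⟨M, hM, h⟩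
  · refine ⟨K + 1, by positivity, fun x hx f => ?_⟩
    obtain ⟨c, rfl⟩ := Finsupp.mem_span_range_iff_exists_finsupp.1 hx
    -- With `δ` below all nonzero coefficients of `f` on the support, the superlevel set is a finite
    -- greedy set of `f` containing every index that matters.
    obtain ⟨δ, hδ, hδc⟩ : ∃ δ : ℝ, 0 < δ ∧
        ∀ n ∈ c.support, f (B.vec n) ≠ 0 → δ ≤ ‖f (B.vec n)‖ := by
      have : ∀ᶠ δ in nhdsWithin (0 : ℝ) (Set.Ioi 0),
          ∀ n ∈ c.support, f (B.vec n) ≠ 0 → δ ≤ ‖f (B.vec n)‖ := by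
        rw [Filter.eventually_all_finset]
        intro n _
        by_cases h0 : f (B.vec n) = 0
        · simp [h0]
        · filter_upwards [nhdsWithin_le_nhds (Iic_mem_nhds (norm_pos_iff.2 h0))] with δ hδ _
          exact hδ
      obtain ⟨δ, h₁, h₂⟩ := (this.and self_mem_nhdsWithin).exists
      exact ⟨δ, h₂, h₁⟩
    refine ⟨_, hmem (h f δ hδ).toFinset fun n => f (B.vec n), ?_, key c f _ fun n hn => ?_⟩
    · refine (hd f _ fun n hn k hk => ?_).trans
        (mul_le_mul_of_nonneg_right (by linarith) (norm_nonneg f))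
      rw [Set.Finite.mem_toFinset] at hn hk
      exact (not_le.1 hk).le.trans hn
    · rw [sum_smul_coord_apply_vec]
      by_cases h0 : f (B.vec n) = 0
      · rw [h0, ite_self]
      · rw [if_pos ((h f δ hδ).mem_toFinset.2 (hδc n hn h0))]
  · have hφ := hB.vec_bound_nonneg 1
    refine ⟨φ 1 * M + 1, by positivity, fun x hx f => ?_⟩
    obtain ⟨c, rfl⟩ := Finsupp.mem_span_range_iff_exists_finsupp.1 hx
    refine ⟨_, hmem c.support fun n => f (B.vec n), ?_, key c f _ fun n hn => ?_⟩
    -- Here any truncation of `f` is bounded, by `φ 1 * M`.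
    · refine le_trans (QuasiNorm.Dual.norm_le (C := φ 1 * M * ‖f‖) (by positivity) fun x => ?_)
        (mul_le_mul_of_nonneg_right (by linarith) (norm_nonneg f))
      rw [sum_smul_coord_apply]
      calc ‖∑ n ∈ c.support, f (B.vec n) * B.coord n x‖
          ≤ ∑ n ∈ c.support, ‖f (B.vec n) * B.coord n x‖ := norm_sum_le _ _
        _ ≤ ∑ n ∈ c.support, φ 1 * ‖f‖ * ‖B.coord n x‖ := Finset.sum_le_sum fun n _ => by
            rw [norm_mul]
            exact mul_le_mul_of_nonneg_right (hB.norm_apply_vec_le f n) (norm_nonneg _)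
        _ = φ 1 * ‖f‖ * ∑ n ∈ c.support, ‖B.coord n x‖ := (Finset.mul_sum _ _ _).symm
        _ ≤ φ 1 * ‖f‖ * (M * N x) := mul_le_mul_of_nonneg_left (h _ x) (by positivity)
        _ = φ 1 * M * ‖f‖ * N x := by ring
    · rw [sum_smul_coord_apply_vec, if_pos hn]

theorem norm_bidualMap_le_of_mem_span {K : ℝ} (hK : 0 ≤ K) (hd : B.IsDualQuasiGreedy K) :
    ∃ L, 0 < L ∧ ∀ x ∈ Submodule.span 𝕜 (Set.range B.vec),
      ‖N.bidualMap x‖ ≤ L * ‖B.bidualMap x‖ := by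
  obtain ⟨L, hL, h⟩ := hB.exists_mem_span_coord hK hd
  refine ⟨L, hL, fun x hx => (N.bidualMap x).opNorm_le_bound (by positivity) fun f => ?_⟩
  obtain ⟨g, hg, hgn, hgx⟩ := h x hx f
  have hgd : g ∈ B.dualSpan := Submodule.le_topologicalClosure _ hg
  calc ‖N.bidualMap x f‖ = ‖B.bidualMap x ⟨g, hgd⟩‖ := by
        rw [bidualMap_apply]
        exact congrArg _ hgx.symm
    _ ≤ ‖B.bidualMap x‖ * ‖g‖ := (B.bidualMap x).le_opNorm ⟨g, hgd⟩
    _ ≤ ‖B.bidualMap x‖ * (L * ‖f‖) := mul_le_mul_of_nonneg_left hgn (norm_nonneg _)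
    _ = L * ‖B.bidualMap x‖ * ‖f‖ := by ring

end HasBidemocracyBounds

theorem norm_bidualMap_le (x : X) : ‖B.bidualMap x‖ ≤ ‖N.bidualMap x‖ :=
  (B.bidualMap x).opNorm_le_bound (norm_nonneg _) fun g => (N.bidualMap x).le_opNorm g

end Bounds

/-! ### Bases of normed spaces: bidual embedding and almost greediness. -/

section Normed

variable {𝕜 : Type} {V : Type u} [RCLike 𝕜] [NormedAddCommGroup V] [NormedSpace 𝕜 V]
  {E : MarkushevichBasis (QuasiNorm.ofNorm 𝕜 V)}

theorem _root_.QuasiNorm.norm_le_of_forall_dual {v : V} {M : ℝ} (hM : 0 ≤ M)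
    (h : ∀ f : (QuasiNorm.ofNorm 𝕜 V).Dual, ‖f v‖ ≤ M * ‖f‖) : ‖v‖ ≤ M := by
  have h₁ := QuasiNorm.norm_le_of_dual_bound (QuasiNorm.ofNorm 𝕜 V) (LinearMap.id (M := V))
    (C := 1) zero_le_one (fun x => (one_mul _).ge) v
  rw [one_mul] at h₁
  exact h₁.trans (ContinuousLinearMap.opNorm_le_bound _ hM h)

theorem norm_eq_norm_bidualMap (v : V) : ‖v‖ = ‖(QuasiNorm.ofNorm 𝕜 V).bidualMap v‖ :=
  le_antisymm (QuasiNorm.norm_le_of_forall_dual (norm_nonneg _) fun f =>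
    ((QuasiNorm.ofNorm 𝕜 V).bidualMap v).le_opNorm f)
    (QuasiNorm.norm_bidualMap_le (QuasiNorm.ofNorm 𝕜 V) v)

namespace HasBidemocracyBounds

variable {φ ψ : ℕ → ℝ} {C K : ℝ} (hE : E.HasBidemocracyBounds φ ψ C) (hK : 0 ≤ K)
  (hd : E.IsDualQuasiGreedy K)

include hE hK hd

theorem isIsomorphicEmbedding_bidualMap :
    IsIsomorphicEmbedding (QuasiNorm.ofNorm 𝕜 V)
      (QuasiNorm.ofNorm 𝕜 (StrongDual 𝕜 E.dualSpan)) E.bidualMap := by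
  obtain ⟨L, hL, h⟩ := hE.norm_bidualMap_le_of_mem_span hK hd
  have hle : ∀ v : V, ‖E.bidualMap v‖ ≤ ‖v‖ := fun v =>
    (norm_bidualMap_le v).trans (norm_eq_norm_bidualMap v).ge
  -- Density carries the lower bound from the span to `V`: replacing `v` by `w` costs `(1 + L) * ‖v
  -- - w‖ < ε`.
  have hge : ∀ v : V, ‖v‖ ≤ L * ‖E.bidualMap v‖ := fun v => by
    refine le_of_forall_pos_le_add fun ε hε => ?_
    obtain ⟨w, hw, hvw⟩ := E.dense_span v (ε / (1 + L)) (by positivity)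
    have hvw : ‖v - w‖ < ε / (1 + L) := hvw
    rw [lt_div_iff₀ (by positivity)] at hvw
    have h₁ : ‖w‖ ≤ L * ‖E.bidualMap w‖ := (norm_eq_norm_bidualMap w).trans_le (h w hw)
    have h₂ : ‖E.bidualMap w‖ ≤ ‖E.bidualMap v‖ + ‖v - w‖ := by
      have := norm_sub_le (E.bidualMap v) (E.bidualMap (v - w))
      rw [← map_sub, sub_sub_cancel] at this
      exact this.trans (by gcongr; exact hle _)
    have h₃ : ‖v‖ ≤ ‖w‖ + ‖v - w‖ := by
      simpa [add_comm] using norm_add_le (v - w) w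
    nlinarith [mul_le_mul_of_nonneg_left h₂ hL.le]
  refine ⟨L + 1, by positivity, fun v => ⟨?_, ?_⟩⟩
  · change (L + 1)⁻¹ * ‖v‖ ≤ ‖E.bidualMap v‖
    rw [inv_mul_le_iff₀ (by positivity)]
    nlinarith [hge v, norm_nonneg (E.bidualMap v)]
  · change ‖E.bidualMap v‖ ≤ (L + 1) * ‖v‖
    nlinarith [hle v, mul_nonneg hL.le (norm_nonneg v)]

/-- The mirror image of `isDualQuasiGreedy`: the functional now supplies the second greedy set,
which exists when its coefficients tend to zero. The norm is recovered from functionals, so local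
convexity is essential. -/
theorem exists_norm_proj_le :
    ∃ Q, 0 ≤ Q ∧ ∀ (v : V) (A : Finset ℕ), E.IsGreedySet v A → ‖E.proj A v‖ ≤ Q * ‖v‖ := by
  have hC := hE.const_nonneg
  rcases hE.finite_superlevel_or_dominates_l1 with h | ⟨M, hM, h⟩
  · refine ⟨K + 32 * C, by positivity, fun v A hA => ?_⟩
    refine QuasiNorm.norm_le_of_forall_dual (𝕜 := 𝕜) (by positivity) fun f => ?_
    obtain ⟨D, hD, hg⟩ := exists_greedySet (fun n => ‖f (E.vec n)‖) (fun _ => norm_nonneg _)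
      (h f) A.card
    have h₁ := hE.norm_sum_sub_sum_le f v hD hg hA
    have h₂ : ‖∑ n ∈ D, f (E.vec n) * E.coord n v‖ ≤ K * ‖f‖ * ‖v‖ := by
      rw [← sum_smul_coord_apply]
      exact (QuasiNorm.Dual.le_norm _ v).trans
        (mul_le_mul_of_nonneg_right (hd f D hg) (norm_nonneg v))
    rw [apply_proj]
    have h₃ := norm_sub_le (∑ n ∈ D, f (E.vec n) * E.coord n v)
      (∑ n ∈ D, f (E.vec n) * E.coord n v - ∑ n ∈ A, f (E.vec n) * E.coord n v)
    rw [sub_sub_cancel] at h₃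
    have h₄ : ‖∑ n ∈ D, f (E.vec n) * E.coord n v - ∑ n ∈ A, f (E.vec n) * E.coord n v‖ ≤
      32 * C * ‖f‖ * ‖v‖ := h₁
    linarith
  · have hφ := hE.vec_bound_nonneg 1
    refine ⟨φ 1 * M, by positivity, fun v A _ => ?_⟩
    calc ‖E.proj A v‖ ≤ ∑ n ∈ A, ‖E.coord n v • E.vec n‖ := norm_sum_le _ _
      _ ≤ ∑ n ∈ A, φ 1 * ‖E.coord n v‖ := Finset.sum_le_sum fun n _ => by
          rw [norm_smul, mul_comm]
          exact mul_le_mul_of_nonneg_right (hE.vec_one_le n) (norm_nonneg _)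
      _ = φ 1 * ∑ n ∈ A, ‖E.coord n v‖ := (Finset.mul_sum _ _ _).symm
      _ ≤ φ 1 * (M * ‖v‖) := mul_le_mul_of_nonneg_left (h A v) hφ
      _ = φ 1 * M * ‖v‖ := by ring

theorem isAlmostGreedy : E.IsAlmostGreedy := by
  obtain ⟨Q, hQ, hg⟩ := hE.exists_norm_proj_le hK hd
  have hC := hE.const_nonneg
  have hφ := hE.vec_bound_nonneg 1
  have hψ := hE.coord_bound_nonneg 1
  refine ⟨⟨φ 1 * ψ 1, fun n => mul_le_mul (hE.vec_one_le n) (hE.coord_one_le n)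
    (norm_nonneg _) hφ⟩, ⟨(ψ 1 + 1)⁻¹, φ 1, by positivity, fun n => ⟨?_, hE.vec_one_le n⟩⟩,
    1 + Q + 16 * C, by linarith, fun v A D hA hDA => ?_⟩
  -- Biorthogonality gives `1 ≤ ‖x_n^*‖ ‖x_n‖`.
  · have h₁ := QuasiNorm.Dual.le_norm (E.coord n) (E.vec n)
    rw [E.biorthogonal, if_pos rfl, norm_one] at h₁
    rw [inv_le_iff_one_le_mul₀ (by positivity), mul_comm]
    refine h₁.trans (mul_le_mul_of_nonneg_right ?_ (QuasiNorm.nonneg' _ _))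
    linarith [hE.coord_one_le n]
  · change ‖v - E.proj A v‖ ≤ (1 + Q + 16 * C) * ‖v - E.proj D v‖
    set w := v - E.proj D v with hw
    have hcoord : ∀ n, E.coord n w = if n ∈ D then 0 else E.coord n v := fun n => by
      rw [hw, map_sub, coord_proj]
      split_ifs <;> simp
    -- `A \ D` is greedy for `w`, so the first two terms cost `1 + Q`. The coefficients of `v` on `D
    -- \ A` lie below those of `w` on the no smaller set `A \ D`, so the pairing estimate bounds the
    -- last term by `16 * C`.
    have hsplit : v - E.proj A v = w - E.proj (A \ D) w + E.proj (D \ A) v := by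
      have h₁ : E.proj (A \ D) w = E.proj (A \ D) v := Finset.sum_congr rfl fun n hn => by
        rw [hcoord, if_neg (Finset.mem_sdiff.1 hn).2]
      have h₂ : E.proj (A \ D) v - E.proj (D \ A) v = E.proj A v - E.proj D v :=
        Finset.sum_sdiff_sub_sum_sdiff
      rw [h₁, hw, sub_add, h₂]
      abel
    have hgr : E.IsGreedySet w (A \ D) := fun n hn k hk => by
      rw [Finset.mem_sdiff] at hn hk
      rw [hcoord, hcoord n, if_neg hn.2]
      by_cases hkD : k ∈ D
      · rw [if_pos hkD, norm_zero]
        exact norm_nonneg _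
      · rw [if_neg hkD]
        exact hA n hn.1 k fun hkA => hk ⟨hkA, hkD⟩
    have hcard : (D \ A).card ≤ (A \ D).card := by
      have h₁ := Finset.card_sdiff_add_card_inter D A
      have h₂ := Finset.card_sdiff_add_card_inter A D
      rw [Finset.inter_comm] at h₂
      omega
    have h₃ : ‖E.proj (D \ A) v‖ ≤ 16 * C * ‖w‖ := by
      refine QuasiNorm.norm_le_of_forall_dual (𝕜 := 𝕜) (by positivity) fun f => ?_
      have h₄ := hE.sum_norm_vec_mul_le f w hcard (β := fun n => ‖E.coord n v‖)
        fun n hn k hk => by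
          rw [Finset.mem_sdiff] at hn hk
          rw [hcoord, if_neg hk.2]
          exact hA k hk.1 n hn.2
      have h₄ : ∑ n ∈ D \ A, ‖f (E.vec n)‖ * ‖E.coord n v‖ ≤ 16 * C * ‖f‖ * ‖w‖ := h₄
      rw [apply_proj]
      refine (norm_sum_le _ _).trans ?_
      simp only [norm_mul]
      linarith
    rw [hsplit]
    have h₅ := norm_add_le (w - E.proj (A \ D) w) (E.proj (D \ A) v)
    have h₆ := norm_sub_le w (E.proj (A \ D) w)
    have h₇ := hg w _ hgr
    linarith

end HasBidemocracyBounds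

end Normed

end MarkushevichBasis

/-! ### Passage to the Banach envelope. -/

namespace QuasiNorm

variable {𝕜 : Type} {X : Type u} [RCLike 𝕜] [AddCommGroup X] [Module 𝕜 X] {N : QuasiNorm 𝕜 X}

namespace IsBanachEnvelope

variable {V : Type u} [NormedAddCommGroup V] [NormedSpace 𝕜 V] {J : X →ₗ[𝕜] V}

/-- Factor `J` through the closure `W` of its range: by uniqueness, the resulting map `V → W`
followed by inclusion is the identity, so `W` is everything. -/
theorem denseRange (h : N.IsBanachEnvelope J) : DenseRange J := by
  have := h.complete
  let W : Submodule 𝕜 V := (LinearMap.range J).topologicalClosure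
  have : CompleteSpace W := (Submodule.isClosed_topologicalClosure _).completeSpace_coe
  have hJW : ∀ x, J x ∈ W := fun x =>
    Submodule.le_topologicalClosure _ (LinearMap.mem_range_self J x)
  obtain ⟨S, hS, -, -⟩ := h.universal W (J.codRestrict W hJW)
    ⟨1, fun x => by rw [one_mul]; exact h.contraction x⟩
  obtain ⟨_, -, huniq, -⟩ := h.universal V J ⟨1, fun x => by rw [one_mul]; exact h.contraction x⟩
  have heq : W.subtypeL.comp S = ContinuousLinearMap.id 𝕜 V :=
    (huniq _ fun x => by
      rw [ContinuousLinearMap.comp_apply, hS]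
      rfl).trans (huniq _ fun x => rfl).symm
  intro v
  have hv : (S v : V) = v := DFunLike.congr_fun heq v
  have hmem : v ∈ W := hv ▸ (S v).2
  have hcl : v ∈ closure (LinearMap.range J : Set V) := hmem
  rwa [LinearMap.coe_range] at hcl

/-- Bounded functionals on `X` extend to the Banach envelope. -/
theorem exists_lift (h : N.IsBanachEnvelope J) :
    ∃ ℓ : N.Dual →ₗ[𝕜] (QuasiNorm.ofNorm 𝕜 V).Dual,
      (∀ f, ‖ℓ f‖ ≤ ‖f‖) ∧ ∀ f x, ℓ f (J x) = f x := by
  have := N.completeSpace_envelopeModel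
  -- One factorization, through the bidual, lifts all functionals at once and linearly. The scalar
  -- field lies in `Type`, hence need not be an admissible target in `Type u`.
  obtain ⟨S, hS, -, hn⟩ := h.universal N.envelopeModel N.toEnvelopeModel
    ⟨1, fun x => by
      rw [one_mul, norm_toEnvelopeModel]
      exact N.norm_bidualMap_le x⟩
  have hS₁ : ‖S‖ ≤ 1 := hn 1 zero_le_one fun x => by
    rw [one_mul, norm_toEnvelopeModel]
    exact N.norm_bidualMap_le x
  have hb : ∀ (f : N.Dual) (v : V), ‖(S v : StrongDual 𝕜 N.Dual) f‖ ≤ ‖f‖ * ‖v‖ := fun f v => by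
    rw [mul_comm]
    refine ((S v : StrongDual 𝕜 N.Dual).le_opNorm f).trans
      (mul_le_mul_of_nonneg_right ?_ (norm_nonneg f))
    have := S.le_of_opNorm_le hS₁ v
    rwa [one_mul] at this
  let g : N.Dual → (QuasiNorm.ofNorm 𝕜 V).Dual := fun f =>
    ⟨{ toFun := fun v => (S v : StrongDual 𝕜 N.Dual) f
       map_add' := fun v w => by rw [map_add, Submodule.coe_add, add_apply]
       map_smul' := fun c v => by
        rw [map_smul, Submodule.coe_smul, smul_apply, RingHom.id_apply] },
      ‖f‖, norm_nonneg f, hb f⟩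
  refine ⟨{ toFun := g
            map_add' := fun f f' => Subtype.ext (LinearMap.ext fun v =>
              map_add (S v : StrongDual 𝕜 N.Dual) f f')
            map_smul' := fun c f => Subtype.ext (LinearMap.ext fun v =>
              map_smul (S v : StrongDual 𝕜 N.Dual) c f) },
    fun f => Dual.norm_le (norm_nonneg f) (hb f), fun f x => ?_⟩
  change (S (J x) : StrongDual 𝕜 N.Dual) f = f x
  rw [hS]
  rfl

/-- One inequality is Hahn–Banach for `J`; the other holds because functionals lift without increase
of norm. -/
theorem norm_apply (h : N.IsBanachEnvelope J) (x : X) : ‖J x‖ = ‖N.bidualMap x‖ := by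
  refine le_antisymm ?_ ?_
  · simpa using norm_le_of_dual_bound N J (C := 1) zero_le_one
      (fun x => by rw [one_mul]; exact h.contraction x) x
  · obtain ⟨ℓ, hℓ, hℓJ⟩ := h.exists_lift
    refine (N.bidualMap x).opNorm_le_bound (norm_nonneg _) fun f => ?_
    calc ‖N.bidualMap x f‖ = ‖ℓ f (J x)‖ := by rw [hℓJ]; rfl
      _ ≤ ‖ℓ f‖ * ‖J x‖ := Dual.le_norm _ _
      _ ≤ ‖J x‖ * ‖f‖ := by
        rw [mul_comm]
        exact mul_le_mul_of_nonneg_left (hℓ f) (norm_nonneg _)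

/-- The image of a basis in the Banach envelope is a basis, which inherits the bidemocracy bounds
and the quasi-greedy estimate for the dual basis. -/
theorem exists_basis (h : N.IsBanachEnvelope J) (B : MarkushevichBasis N) :
    ∃ E : MarkushevichBasis (QuasiNorm.ofNorm 𝕜 V), (∀ n, E.vec n = J (B.vec n)) ∧
      (∀ φ ψ C, B.HasBidemocracyBounds φ ψ C → E.HasBidemocracyBounds φ ψ C) ∧
      ∀ K, 0 ≤ K → B.IsDualQuasiGreedy K → E.IsDualQuasiGreedy K := by
  obtain ⟨ℓ, hℓ, hℓJ⟩ := h.exists_lift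
  let E : MarkushevichBasis (QuasiNorm.ofNorm 𝕜 V) :=
    { vec := fun n => J (B.vec n)
      coord := fun n => ℓ (B.coord n)
      biorthogonal := fun n k => by rw [hℓJ, B.biorthogonal]
      dense_span := fun v ε hε => by
        obtain ⟨x, hx⟩ := h.denseRange.exists_dist_lt v (half_pos hε)
        obtain ⟨g, hg, hxg⟩ := B.dense_span x (ε / 2) (half_pos hε)
        refine ⟨J g, ?_, ?_⟩
        · have := Submodule.mem_map_of_mem (f := J) hg
          rwa [Submodule.map_span, ← Set.range_comp] at this
        · change ‖v - J g‖ < ε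
          have h₁ := norm_add_le (v - J x) (J (x - g))
          rw [map_sub, sub_add_sub_cancel, ← map_sub] at h₁
          rw [dist_eq_norm] at hx
          linarith [h.contraction (x - g)] }
  refine ⟨E, fun _ => rfl, fun φ ψ C hB => ⟨fun m A hA => ?_, fun m A hA => ?_, hB.mul_le⟩,
    fun K hK hd f A hA => ?_⟩
  · change ‖∑ n ∈ A, J (B.vec n)‖ ≤ φ m
    rw [← map_sum]
    exact (h.contraction _).trans (hB.vec_le m A hA)
  · change ‖∑ n ∈ A, ℓ (B.coord n)‖ ≤ ψ m
    rw [← map_sum]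
    exact (hℓ _).trans (hB.coord_le m A hA)
  -- The pullback of `f` along `J` has the same coefficients, hence the same greedy sets, and no
  -- larger norm.
  · have hb : ∀ x, ‖(Dual.toLin f ∘ₗ J) x‖ ≤ ‖f‖ * N x := fun x =>
      (Dual.le_norm f (J x)).trans
        (mul_le_mul_of_nonneg_left (h.contraction x) (norm_nonneg f))
    let f' : N.Dual := ⟨Dual.toLin f ∘ₗ J, ‖f‖, norm_nonneg f, hb⟩
    have hf' : ‖f'‖ ≤ ‖f‖ := Dual.norm_le (norm_nonneg f) hb
    have h₁ := hd f' A hA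
    have h₂ : ∑ n ∈ A, f (E.vec n) • E.coord n = ℓ (∑ n ∈ A, f' (B.vec n) • B.coord n) := by
      rw [map_sum]
      exact Finset.sum_congr rfl fun n _ => (map_smul ℓ _ _).symm
    rw [h₂]
    exact (hℓ _).trans (h₁.trans (mul_le_mul_of_nonneg_left hf' hK))

end IsBanachEnvelope

/-! ### Local convexity: the quasi-norm against the bidual norm. -/

section LocallyConvex

/-- The largest seminorm dominated by a quasi-norm. -/
noncomputable def envelopeSeminorm (N : QuasiNorm 𝕜 X) : Seminorm 𝕜 X :=
  have hbdd : ∀ x, BddBelow ((fun s : Multiset X => (s.map N).sum) '' {s | s.sum = x}) := fun x =>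
    ⟨0, by
      rintro _ ⟨s, -, rfl⟩
      exact Multiset.sum_nonneg fun r hr => by
        obtain ⟨y, -, rfl⟩ := Multiset.mem_map.1 hr
        exact N.nonneg' y⟩
  have hne : ∀ x, ((fun s : Multiset X => (s.map N).sum) '' {s | s.sum = x}).Nonempty := fun x =>
    ⟨_, {x}, by simp, rfl⟩
  -- The infimum runs over all finite decompositions of `x`, each priced by the sum of its
  -- quasi-norms.
  Seminorm.ofSMulLE (fun x => sInf ((fun s : Multiset X => (s.map N).sum) '' {s | s.sum = x}))
    (le_antisymm (csInf_le (hbdd 0) ⟨0, by simp⟩) (Real.sInf_nonneg (by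
      rintro _ ⟨s, -, rfl⟩
      exact Multiset.sum_nonneg fun r hr => by
        obtain ⟨y, -, rfl⟩ := Multiset.mem_map.1 hr
        exact N.nonneg' y)))
    (fun x y => by
      rw [← csInf_add (hne x) (hbdd x) (hne y) (hbdd y)]
      refine le_csInf ((hne x).add (hne y)) ?_
      rintro _ ⟨_, ⟨s, hs, rfl⟩, _, ⟨t, ht, rfl⟩, rfl⟩
      refine csInf_le (hbdd _) ⟨s + t, ?_, by simp⟩
      rw [Set.mem_ofPred_eq] at hs ht ⊢
      rw [Multiset.sum_add, hs, ht])
    (fun c x => by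
      rw [← smul_eq_mul, ← Real.sInf_smul_of_nonneg (norm_nonneg c)]
      refine le_csInf (hne x).smul_set ?_
      rintro _ ⟨_, ⟨s, hs, rfl⟩, rfl⟩
      refine csInf_le (hbdd _) ⟨s.map (c • ·), ?_, ?_⟩
      · rw [Set.mem_ofPred_eq] at hs ⊢
        rw [← Multiset.smul_sum, hs]
      · simp only [Multiset.map_map, Function.comp_def]
        rw [smul_eq_mul, ← Multiset.sum_map_mul_left]
        exact congrArg _ (Multiset.map_congr rfl fun y _ => N.smul' c y))

theorem envelopeSeminorm_le (N : QuasiNorm 𝕜 X) (x : X) : N.envelopeSeminorm x ≤ N x :=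
  csInf_le ⟨0, by
      rintro _ ⟨s, -, rfl⟩
      exact Multiset.sum_nonneg fun r hr => by
        obtain ⟨y, -, rfl⟩ := Multiset.mem_map.1 hr
        exact N.nonneg' y⟩ ⟨{x}, by simp, by simp⟩

/-- Local convexity bounds below the price of every decomposition; `|C| + 1` makes the constant
positive. -/
theorem IsLocallyConvex.le_envelopeSeminorm (h : N.IsLocallyConvex) :
    ∃ C, 0 < C ∧ ∀ x, N x ≤ C * N.envelopeSeminorm x := by
  obtain ⟨C, hC⟩ := h
  have hpos : 0 < |C| + 1 := by positivity
  refine ⟨|C| + 1, hpos, fun x => ?_⟩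
  rw [← div_le_iff₀' hpos]
  refine le_csInf ⟨_, {x}, by simp, rfl⟩ ?_
  rintro _ ⟨s, rfl, rfl⟩
  rw [div_le_iff₀' hpos]
  obtain ⟨l, rfl⟩ := Quot.exists_rep s
  have h₁ := hC l.length l.get
  have h₂ : ∑ j, l.get j = l.sum := by
    rw [← List.sum_ofFn, List.ofFn_get]
  have h₃ : ∑ j, N (l.get j) = (l.map N).sum := by
    rw [← List.sum_ofFn, show (fun j => N (l.get j)) = N.toFun ∘ l.get from rfl, ← List.map_ofFn,
      List.ofFn_get]
  have h₄ : 0 ≤ ∑ j, N (l.get j) := Finset.sum_nonneg fun j _ => N.nonneg' _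
  rw [h₂, h₃] at h₁
  rw [h₃] at h₄
  refine h₁.trans (mul_le_mul_of_nonneg_right ?_ h₄)
  linarith [le_abs_self C]

theorem _root_.Seminorm.exists_dual_vector (p : Seminorm 𝕜 X) (x : X) (hx : x ≠ 0) :
    ∃ g : X →ₗ[𝕜] 𝕜, (∀ y, ‖g y‖ ≤ p y) ∧ g x = p x := by
  let e := LinearEquiv.toSpanNonzeroSingleton 𝕜 X x hx
  have he : ∀ z, ((e.symm z : 𝕜) • x : X) = z := fun z =>
    congrArg Subtype.val (e.apply_symm_apply z)
  -- Hahn–Banach applied to `t • x ↦ t * p x` on the line through `x`.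
  obtain ⟨g, hg, hgp⟩ := Module.Dual.exists_extension_of_le_seminorm (𝕜 := 𝕜) (p := p) _
    (((p x : ℝ) : 𝕜) • e.symm.toLinearMap) fun z => by
      conv_rhs => rw [← he z]
      rw [map_smul_eq_mul, LinearMap.smul_apply, smul_eq_mul, norm_mul, RCLike.norm_ofReal,
        abs_of_nonneg (apply_nonneg p x), mul_comm]
      rfl
  refine ⟨g, hgp, ?_⟩
  have h₁ := hg (e 1)
  rw [LinearMap.smul_apply, LinearEquiv.coe_coe, e.symm_apply_apply, smul_eq_mul, mul_one] at h₁
  rw [← h₁]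
  exact congrArg g (one_smul 𝕜 x).symm

theorem IsLocallyConvex.le_norm_bidualMap (h : N.IsLocallyConvex) :
    ∃ C, 0 < C ∧ ∀ x, N x ≤ C * ‖N.bidualMap x‖ := by
  obtain ⟨C, hC, hle⟩ := h.le_envelopeSeminorm
  refine ⟨C, hC, fun x => (hle x).trans (mul_le_mul_of_nonneg_left ?_ hC.le)⟩
  rcases eq_or_ne x 0 with rfl | hx
  · rw [map_zero]
    exact norm_nonneg _
  obtain ⟨g, hg, hgx⟩ := N.envelopeSeminorm.exists_dual_vector x hx
  have hgN : ∀ y, ‖g y‖ ≤ 1 * N y := fun y => by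
    rw [one_mul]
    exact (hg y).trans (N.envelopeSeminorm_le y)
  let f : N.Dual := ⟨g, 1, zero_le_one, hgN⟩
  calc N.envelopeSeminorm x = ‖N.bidualMap x f‖ := by
        change _ = ‖g x‖
        rw [hgx, RCLike.norm_ofReal, abs_of_nonneg (apply_nonneg _ x)]
    _ ≤ ‖N.bidualMap x‖ * ‖f‖ := (N.bidualMap x).le_opNorm f
    _ ≤ ‖N.bidualMap x‖ := mul_le_of_le_one_right (norm_nonneg _) (Dual.norm_le zero_le_one hgN)

end LocallyConvex

end QuasiNorm

/-! ### Assembly of the theorem. -/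

theorem MarkushevichBasis.sum_smul_bidualSeq {𝕜 : Type} {X : Type u} [RCLike 𝕜] [AddCommGroup X]
    [Module 𝕜 X] {N : QuasiNorm 𝕜 X} (B : MarkushevichBasis N) (A : Finset ℕ) (a : ℕ → 𝕜) :
    ∑ n ∈ A, a n • B.bidualSeq n = B.bidualMap (∑ n ∈ A, a n • B.vec n) := by
  rw [map_sum]
  exact Finset.sum_congr rfl fun n _ => (map_smul B.bidualMap _ _).symm

theorem MarkushevichBasis.sum_smul_vec_mem_span {𝕜 : Type} {X : Type u} [RCLike 𝕜]
    [AddCommGroup X] [Module 𝕜 X] {N : QuasiNorm 𝕜 X} (B : MarkushevichBasis N) (A : Finset ℕ)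
    (a : ℕ → 𝕜) : ∑ n ∈ A, a n • B.vec n ∈ Submodule.span 𝕜 (Set.range B.vec) :=
  Submodule.sum_mem _ fun n _ => Submodule.smul_mem _ _ (Submodule.subset_span ⟨n, rfl⟩)

theorem mainTheorem9 {𝕜 : Type} [RCLike 𝕜] {X : Type u} [AddCommGroup X] [Module 𝕜 X]
    (N : QuasiNorm 𝕜 X) (hN : N.IsQuasiBanach) (B : MarkushevichBasis N)
    (hbd : B.IsBidemocratic) (hqg : B.IsQuasiGreedy) :
    (∀ (V : Type u) [NormedAddCommGroup V] [NormedSpace 𝕜 V] (J : X →ₗ[𝕜] V),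
      N.IsBanachEnvelope J →
        ∃ E : MarkushevichBasis (QuasiNorm.ofNorm 𝕜 V), (∀ n, E.vec n = J (B.vec n)) ∧
          IsIsomorphicEmbedding (QuasiNorm.ofNorm 𝕜 V)
            (QuasiNorm.ofNorm 𝕜 (StrongDual 𝕜 E.dualSpan)) E.bidualMap ∧
          SeqEquivalent (QuasiNorm.ofNorm 𝕜 (StrongDual 𝕜 B.dualSpan)) B.bidualSeq
            (QuasiNorm.ofNorm 𝕜 V) E.vec ∧
          E.IsAlmostGreedy) ∧
    (N.IsLocallyConvex →
      SeqEquivalent N B.vec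
        (QuasiNorm.ofNorm 𝕜 (StrongDual 𝕜 B.dualSpan)) B.bidualSeq) := by
  obtain ⟨φ, ψ, C, hB⟩ := hbd.exists_bounds
  obtain ⟨K, hK, hd⟩ := hB.isDualQuasiGreedy hqg
  obtain ⟨L, hL, hle⟩ := hB.norm_bidualMap_le_of_mem_span hK hd
  refine ⟨fun V _ _ J hJ => ?_, fun hlc => ?_⟩
  · obtain ⟨E, hvec, hEB, hEd⟩ := hJ.exists_basis B
    have hE := hEB _ _ _ hB
    refine ⟨E, hvec, hE.isIsomorphicEmbedding_bidualMap hK (hEd K hK hd),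
      ⟨L + 1, by positivity, fun m a => ?_⟩, hE.isAlmostGreedy hK (hEd K hK hd)⟩
    have hsum : ∑ n ∈ Finset.range m, a n • E.vec n =
        J (∑ n ∈ Finset.range m, a n • B.vec n) := by simp only [hvec, map_sum, map_smul]
    rw [B.sum_smul_bidualSeq, hsum]
    have h₁ := hle _ (B.sum_smul_vec_mem_span (Finset.range m) a)
    set x := ∑ n ∈ Finset.range m, a n • B.vec n
    change (L + 1)⁻¹ * ‖B.bidualMap x‖ ≤ ‖J x‖ ∧ ‖J x‖ ≤ (L + 1) * ‖B.bidualMap x‖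
    have h₂ := MarkushevichBasis.norm_bidualMap_le (B := B) x
    -- As the envelope norm is the bidual norm, restriction to the dual span changes it by a factor
    -- at most `L`.
    rw [← hJ.norm_apply] at h₁ h₂
    rw [inv_mul_le_iff₀ (by positivity)]
    constructor <;> nlinarith [norm_nonneg (J x), norm_nonneg (B.bidualMap x)]
  · obtain ⟨D, hD, hND⟩ := hlc.le_norm_bidualMap
    refine ⟨D * L + 1, by positivity, fun m a => ?_⟩
    rw [B.sum_smul_bidualSeq]
    have h₁ := hle _ (B.sum_smul_vec_mem_span (Finset.range m) a)
    set x := ∑ n ∈ Finset.range m, a n • B.vec n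
    change (D * L + 1)⁻¹ * N x ≤ ‖B.bidualMap x‖ ∧ ‖B.bidualMap x‖ ≤ (D * L + 1) * N x
    have h₂ := MarkushevichBasis.norm_bidualMap_le (B := B) x
    have h₃ := N.norm_bidualMap_le x
    have h₄ := (hND x).trans (mul_le_mul_of_nonneg_left h₁ hD.le)
    have hDL := mul_nonneg (mul_pos hD hL).le (N.nonneg' x)
    rw [inv_mul_le_iff₀ (by positivity)]
    constructor <;> linarith [norm_nonneg (B.bidualMap x)]
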